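/- All topological groups are assumed to be Hausdorff. A continuous map is called perfect if it is closed and surjective and all its fibers are compact. A topological group $G$ is called $P\mathcal{M}$-factorizable if for every continuous function $\varphi : G \to \mathbb{R}$ there exist a metrizable topological group $K$, a perfect homomorphism $\pi : G \to K$ onto $K$, and a continuous function $g : K \to \mathbb{R}$ such that $\varphi = g \circ \pi$. Theorem. Let $G$ and $H$ be topological groups and let $f : G \to H$ be an open continuous homomorphism of $G$ onto $H$. If $G$ is $P\mathcal{M}$-factorizable, then $H$ is $P\mathcal{M}$-factorizable. -/

import Mathlib

universe u v

/-- A perfect map: a continuous closed surjection all of whose fibers are compact. -/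
structure IsPerfectMap {X : Type u} {Y : Type v} [TopologicalSpace X] [TopologicalSpace Y]
    (f : X → Y) : Prop where
  continuous : Continuous f
  isClosedMap : IsClosedMap f
  surjective : Function.Surjective f
  isCompact_fiber : ∀ y : Y, IsCompact (f ⁻¹' {y})

/-- A topological group `G` is `PM`-factorizable if every continuous real-valued function on `G`
factors as `g ∘ π`, with `π` a perfect homomorphism onto a metrizable topological group `K` and
`g : K → ℝ` continuous. As `π` is onto, letting `K` range over the universe of `G` is no
restriction. -/
def PMFactorizable (G : Type u) [Group G] [TopologicalSpace G] : Prop :=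
  ∀ f : G → ℝ, Continuous f →
    ∃ (K : Type u) (_ : Group K) (_ : TopologicalSpace K) (_ : IsTopologicalGroup K)
      (_ : TopologicalSpace.MetrizableSpace K) (π : G →* K) (g : K → ℝ),
      IsPerfectMap π ∧ Continuous g ∧ f = g ∘ π

open Topology Filter

/-! Factor `φ ∘ f` through a perfect `π : G → K` and push the compact kernel of `π` forward to `D =
f(ker π)`, a compact normal subgroup of `H`. Then `H → H ⧸ D` is perfect and `φ` descends to `H ⧸
D`. This quotient is metrizable because it is also an open continuous image of `K`, hence first
countable at the identity. -/

/-- The Birkhoff–Kakutani theorem: a Hausdorff group whose neighbourhood filter at the identity is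
countably generated is metrizable. -/
theorem metrizableSpace_of_nhds_one_isCountablyGenerated (G : Type*) [Group G]
    [TopologicalSpace G] [IsTopologicalGroup G] [T2Space G] [(𝓝 (1 : G)).IsCountablyGenerated] :
    TopologicalSpace.MetrizableSpace G := by
  let : UniformSpace G := IsTopologicalGroup.rightUniformSpace G
  have : (uniformity G).IsCountablyGenerated :=
    inferInstanceAs ((comap _ (𝓝 (1 : G))).IsCountablyGenerated)
  exact UniformSpace.metrizableSpace

/-- The quotient homomorphism of a topological group by a compact normal subgroup is perfect. -/
theorem isPerfectMap_quotientGroup_mk' {G : Type*} [Group G] [TopologicalSpace G]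
    [IsTopologicalGroup G] (N : Subgroup G) [N.Normal] (hN : IsCompact (N : Set G)) :
    IsPerfectMap (QuotientGroup.mk' N) where
  continuous := continuous_quotient_mk'
  isClosedMap := QuotientGroup.isClosedMap_coe hN
  surjective := QuotientGroup.mk'_surjective N
  isCompact_fiber y := by
    obtain ⟨x, rfl⟩ := QuotientGroup.mk'_surjective N y
    have : QuotientGroup.mk' N ⁻¹' {QuotientGroup.mk' N x} = (fun n => x * n) '' (N : Set G) := by
      ext z
      simp only [Set.mem_preimage, Set.mem_singleton_iff, Set.mem_image, SetLike.mem_coe]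
      rw [eq_comm]
      simp only [QuotientGroup.mk'_apply, QuotientGroup.eq]
      exact ⟨fun h => ⟨x⁻¹ * z, h, by group⟩, by rintro ⟨n, hn, rfl⟩; simpa using hn⟩
    rw [this]
    exact hN.image (continuous_const_mul x)

theorem theorem3p11 {G : Type u} {H : Type v}
    [Group G] [TopologicalSpace G] [IsTopologicalGroup G] [T2Space G]
    [Group H] [TopologicalSpace H] [IsTopologicalGroup H] [T2Space H]
    (hG : PMFactorizable G) (f : G →* H) (hf_cont : Continuous f) (hf_open : IsOpenMap f)
    (hf_surj : Function.Surjective f) : PMFactorizable H := by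
  intro φ hφ
  obtain ⟨K, _, _, _, _, π, g, hπ, -, hg⟩ := hG (φ ∘ f) (hφ.comp hf_cont)
  let D : Subgroup H := π.ker.map f
  have : D.Normal := Subgroup.Normal.map inferInstance f hf_surj
  have hD : IsCompact (D : Set H) := (hπ.isCompact_fiber 1).image hf_cont
  -- Closedness of `D` makes `H ⧸ D` Hausdorff, as Birkhoff–Kakutani requires.
  have : IsClosed (D : Set H) := hD.isClosed
  have hq : IsOpenQuotientMap (QuotientGroup.mk' D) := QuotientGroup.isOpenQuotientMap_mk
  let ρ : G →* H ⧸ D := (QuotientGroup.mk' D).comp f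
  have hρ_cont : Continuous ρ := hq.continuous.comp hf_cont
  have hρ_open : IsOpenMap ρ := hq.isOpenMap.comp hf_open
  have hker : π.ker ≤ ρ.ker := fun c hc =>
    (QuotientGroup.eq_one_iff (N := D) (f c)).2 ⟨c, hc, rfl⟩
  -- The induced map `K → H ⧸ D` is continuous and open, as `π` is a quotient map.
  let ψ : K →* H ⧸ D := π.liftOfSurjective hπ.surjective ⟨ρ, hker⟩
  have hψ (x : G) : ψ (π x) = ρ x :=
    π.liftOfRightInverse_comp_apply _ (Function.rightInverse_surjInv hπ.surjective) ⟨ρ, hker⟩ x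
  have hψ_comp : ψ ∘ π = ρ := funext hψ
  have hψ_cont : Continuous ψ := by
    rw [(hπ.isClosedMap.isQuotientMap hπ.continuous hπ.surjective).continuous_iff, hψ_comp]
    exact hρ_cont
  have hψ_open : IsOpenMap ψ := fun U hU => by
    rw [← Set.image_preimage_eq U hπ.surjective, ← Set.image_comp, hψ_comp]
    exact hρ_open _ (hU.preimage hπ.continuous)
  have : (𝓝 (1 : H ⧸ D)).IsCountablyGenerated := by
    -- `𝓝 1` in `H ⧸ D` is the image under `ψ` of `𝓝 1` in the metrizable group `K`.
    rw [← map_one ψ, ← hψ_open.map_nhds_eq hψ_cont.continuousAt]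
    infer_instance
  -- `φ` is constant on the cosets of `D`, because `φ ∘ f` factors through `π`.
  have hφD (a b : H) (hab : QuotientGroup.mk' D a = QuotientGroup.mk' D b) : φ a = φ b := by
    obtain ⟨c, hc, hcab⟩ := QuotientGroup.eq.1 hab
    obtain ⟨x, rfl⟩ := hf_surj a
    have hb : b = f (x * c) := by rw [map_mul, hcab, mul_inv_cancel_left]
    have hxc : π (x * c) = π x := by rw [map_mul, MonoidHom.mem_ker.1 hc, mul_one]
    rw [hb]
    exact (congrFun hg x).trans ((congrArg g hxc.symm).trans (congrFun hg (x * c)).symm)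
  let γ : H ⧸ D → ℝ := Quotient.lift φ fun a b hab => hφD a b (Quotient.sound hab)
  exact ⟨H ⧸ D, inferInstance, inferInstance, inferInstance,
    metrizableSpace_of_nhds_one_isCountablyGenerated _, QuotientGroup.mk' D, γ,
    isPerfectMap_quotientGroup_mk' D hD, hφ.quotient_lift _, rfl⟩
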